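/- A group topology $\tau$ on an Abelian group $G$ is called totally bounded if it is Hausdorff and for every nonempty $\tau$-open set $U\subseteq G$ there is a finite set $F\subseteq G$ with $G=F+U$. It is called an SC-group topology if it is totally bounded and every subgroup of $G$ is $\tau$-closed. An Abelian group $G$ is of bounded order if there is an integer $n\ge 1$ with $ng=0$ for all $g\in G$. Let $\mathfrak c=2^{\aleph_0}$. Then the following statements hold. (a) If $G$ is an Abelian group which is not of bounded order, then $G$ admits at least $2^{\mathfrak c}$ many SC-group topologies. (b) If $G$ is a countable Abelian group which is not of bounded order, then $G$ admits exactly $2^{\mathfrak c}$ many SC-group topologies. -/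

import Mathlib

open scoped Pointwise Topology

/-- `τ` is a precompact group topology on `G`: the group operations are continuous, and finitely
many translates of any nonempty open set cover `G`. -/
structure IsPrecompactGroupTopology {G : Type*} [AddGroup G] (τ : TopologicalSpace G) : Prop where
  isTopologicalAddGroup : @IsTopologicalAddGroup G τ _
  exists_finite_cover : ∀ U : Set G, IsOpen[τ] U → U.Nonempty →
    ∃ F : Set G, F.Finite ∧ F + U = Set.univ

/-- `τ` is a totally bounded group topology on `G`: it is precompact and Hausdorff. -/
structure IsTotallyBoundedGroupTopology {G : Type*} [AddGroup G] (τ : TopologicalSpace G) : Prop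
    extends IsPrecompactGroupTopology τ where
  t2Space : @T2Space G τ

/-- `τ` is an SC-group topology on `G`: it is a totally bounded group topology for which every
subgroup of `G` is closed. -/
structure IsSCGroupTopology {G : Type*} [AddGroup G] (τ : TopologicalSpace G) : Prop
    extends IsTotallyBoundedGroupTopology τ where
  isClosed_addSubgroup : ∀ H : AddSubgroup G, IsClosed[τ] (H : Set G)

/-- The group `G` is of bounded order: `n • g = 0` for all `g`, for some integer `n ≥ 1`. -/
def IsOfBoundedOrder (G : Type*) [AddGroup G] : Prop :=
  ∃ n : ℕ, 1 ≤ n ∧ ∀ g : G, n • g = 0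

/-! A subgroup `H` of the character group `Hom(G, 𝕋)` induces a precompact topology on `G` whose
continuous characters are exactly those in `H` (`mem_of_continuous_charTopology`), so distinct `H`
give distinct topologies. It suffices to find `2 ^ 𝔠` subgroups inducing SC-topologies.

Kernels of homomorphisms `φ : Hom(G, 𝕋) → ℚ` always do (`exists_mem_ker_separating`): a point
outside a subgroup `L` is detected by a map of `G ⧸ L` to a Prüfer group, whose `ℤ_p`-multiples form
an uncountable family of characters. As `ℚ` is countable and torsion-free, `φ` kills the character
of some `p`-adic unit multiple, which still detects the point.

If `G` is unbounded, `Hom(G, 𝕋)` contains `𝔠` independent elements, and prescribing `φ` as `0` or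
`1` on them yields `2 ^ 𝔠` kernels. For countable `G`, there are at most `2 ^ 𝔠` topologies at all.
-/

/-- The continuous complex functions given by the continuous characters of a topological group. -/
noncomputable def charToContinuousMap (S : Type*) [AddCommGroup S] [TopologicalSpace S] :
    Multiplicative (S →ₜ+ UnitAddCircle) →* C(S, ℂ) where
  toFun χ := ⟨fun s => (AddCircle.toCircle (χ.toAdd s) : ℂ), by
    have := χ.toAdd.continuous_toFun
    exact continuous_subtype_val.comp (AddCircle.continuous_toCircle.comp this)⟩
  map_one' := by ext s; simp
  map_mul' χ ψ := by
    ext s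
    simp [ContinuousAddMonoidHom.add_apply, AddCircle.toCircle_add]

/-! ### Characters of compact groups: orthogonality and Stone–Weierstrass. -/

section Compact

variable {S : Type*} [AddCommGroup S] [TopologicalSpace S]

theorem charToContinuousMap_apply (χ : S →ₜ+ UnitAddCircle) (s : S) :
    charToContinuousMap S (.ofAdd χ) s = (AddCircle.toCircle (χ s) : ℂ) := rfl

theorem star_charToContinuousMap (χ : S →ₜ+ UnitAddCircle) :
    star (charToContinuousMap S (.ofAdd χ)) = charToContinuousMap S (.ofAdd (-χ)) := by
  ext s
  have : (-χ) s = -(χ s) := rfl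
  simp only [ContinuousMap.star_apply, charToContinuousMap_apply, this, AddCircle.toCircle_neg,
    Circle.coe_inv_eq_conj]
  rfl

variable [IsTopologicalAddGroup S]

/-- The integral of a nontrivial character of a compact group is zero. -/
theorem integral_charToContinuousMap_eq_zero [MeasurableSpace S] [BorelSpace S]
    (μ : MeasureTheory.Measure S) [μ.IsAddHaarMeasure] {χ : S →ₜ+ UnitAddCircle} (hχ : χ ≠ 0) :
    ∫ s, charToContinuousMap S (.ofAdd χ) s ∂μ = 0 := by
  obtain ⟨t, ht⟩ : ∃ t, χ t ≠ 0 := by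
    by_contra! h
    exact hχ (ContinuousAddMonoidHom.ext h)
  have h1 := MeasureTheory.integral_add_left_eq_self (μ := μ)
    (fun s => charToContinuousMap S (.ofAdd χ) s) t
  simp only [charToContinuousMap_apply, map_add, AddCircle.toCircle_add, Circle.coe_mul] at h1 ⊢
  rw [MeasureTheory.integral_const_mul] at h1
  have h2 : (AddCircle.toCircle (χ t) : ℂ) ≠ 1 := by
    intro h
    apply ht
    apply AddCircle.injective_toCircle one_ne_zero
    rw [AddCircle.toCircle_zero]
    exact Circle.ext h
  have h3 : ((AddCircle.toCircle (χ t) : ℂ) - 1) *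
      ∫ s, (AddCircle.toCircle (χ s) : ℂ) ∂μ = 0 := by rw [sub_mul, h1]; ring
  exact (mul_eq_zero.1 h3).resolve_left (sub_ne_zero.2 h2)

/-- A point-separating group of continuous characters of a compact Hausdorff group contains every
continuous character. -/
theorem eq_top_of_separating [CompactSpace S] [T2Space S] (H : AddSubgroup (S →ₜ+ UnitAddCircle))
    (hH : ∀ s : S, (∀ χ ∈ H, χ s = 0) → s = 0) : H = ⊤ := by
  rw [eq_top_iff]
  intro χ _
  by_contra hχ
  let R : Submonoid C(S, ℂ) := (H.toAddSubmonoid.toSubmonoid).map (charToContinuousMap S)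
  let A : StarSubalgebra ℂ C(S, ℂ) :=
    { Algebra.adjoin ℂ (R : Set C(S, ℂ)) with
      star_mem' := by
        change Algebra.adjoin ℂ (R : Set C(S, ℂ)) ≤ star (Algebra.adjoin ℂ (R : Set C(S, ℂ)))
        refine Algebra.adjoin_le ?_
        rintro - ⟨ψ, hψ, rfl⟩
        refine Algebra.subset_adjoin ⟨.ofAdd (-ψ.toAdd), H.neg_mem hψ, ?_⟩
        exact (star_charToContinuousMap ψ.toAdd).symm }
  have hA : A.topologicalClosure = ⊤ := by
    apply ContinuousMap.starSubalgebra_topologicalClosure_eq_top_of_separatesPoints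
    intro x y hxy
    obtain ⟨ψ, hψ, hne⟩ : ∃ ψ ∈ H, ψ (x - y) ≠ 0 := by
      by_contra! h
      exact hxy (sub_eq_zero.1 (hH _ h))
    refine ⟨_, ⟨charToContinuousMap S (.ofAdd ψ), Algebra.subset_adjoin ⟨.ofAdd ψ, hψ, rfl⟩, rfl⟩, ?_⟩
    intro h
    apply hne
    rw [map_sub, sub_eq_zero]
    exact AddCircle.injective_toCircle one_ne_zero (Circle.ext h)
  let _ : MeasurableSpace S := borel S
  have : BorelSpace S := ⟨rfl⟩
  let μ : MeasureTheory.Measure S := MeasureTheory.Measure.addHaar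
  have hint (f : C(S, ℂ)) : MeasureTheory.Integrable f μ := by
    have := f.continuous.integrable_of_hasCompactSupport (μ := μ)
      (HasCompactSupport.of_compactSpace _)
    exact this
  -- `R` is closed under products, so `A` is its linear span and orthogonality need only be checked
  -- on characters in `H`.
  have horth : ∀ f ∈ A, ∫ s, (f * charToContinuousMap S (.ofAdd (-χ))) s ∂μ = 0 := by
    intro f hf
    have hf' : f ∈ Submodule.span ℂ (R : Set C(S, ℂ)) := by
      rw [← Submonoid.closure_eq R, ← Algebra.adjoin_eq_span]
      exact hf
    clear hf
    induction hf' using Submodule.span_induction with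
    | mem x hx =>
      obtain ⟨ψ, hψ, rfl⟩ := hx
      rw [← map_mul]
      rw [show ψ * .ofAdd (-χ) = .ofAdd (ψ.toAdd - χ) by rw [sub_eq_add_neg]; rfl]
      refine integral_charToContinuousMap_eq_zero μ (χ := ψ.toAdd - χ) ?_
      intro h
      apply hχ
      rw [← sub_eq_zero.1 h]
      exact hψ
    | zero => simp
    | add x y hx hy h1 h2 =>
      simp only [add_mul, ContinuousMap.add_apply]
      rw [MeasureTheory.integral_add (hint _) (hint _), h1, h2, add_zero]
    | smul a x hx h =>
      simp only [smul_mul_assoc, ContinuousMap.smul_apply]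
      rw [MeasureTheory.integral_smul, h, smul_zero]
  have hmem : charToContinuousMap S (.ofAdd χ) ∈ closure (A : Set C(S, ℂ)) := by
    rw [← StarSubalgebra.topologicalClosure_coe, hA]; trivial
  obtain ⟨f, hf, hd⟩ := Metric.mem_closure_iff.1 hmem (1 / 2) (by norm_num)
  have h0 := horth f hf
  have hone : charToContinuousMap S (.ofAdd χ) * charToContinuousMap S (.ofAdd (-χ)) = 1 := by
    rw [← map_mul, ← ofAdd_add, add_neg_cancel, ofAdd_zero, map_one]
  -- The integral is the full mass, yet the integrand is bounded by `1 / 2`.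
  have h1 : ∫ s, ((charToContinuousMap S (.ofAdd χ) - f) * charToContinuousMap S (.ofAdd (-χ))) s ∂μ
      = μ.real Set.univ := by
    rw [sub_mul, hone]
    simp only [ContinuousMap.sub_apply]
    rw [MeasureTheory.integral_sub (hint _) (hint _), h0]
    simp
  have h2 := MeasureTheory.norm_integral_le_of_norm_le_const (μ := μ) (C := 1 / 2)
    (f := ((charToContinuousMap S (.ofAdd χ) - f) * charToContinuousMap S (.ofAdd (-χ))))
    (Filter.Eventually.of_forall fun s => by
      rw [ContinuousMap.mul_apply, norm_mul, charToContinuousMap_apply (-χ), Circle.norm_coe, mul_one]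
      refine (ContinuousMap.norm_coe_le_norm _ s).trans ?_
      rw [← dist_eq_norm]
      exact hd.le)
  rw [h1] at h2
  have hpos : 0 < μ.real Set.univ := by
    rw [MeasureTheory.measureReal_def]
    exact ENNReal.toReal_pos (isOpen_univ.measure_ne_zero μ Set.univ_nonempty)
      (MeasureTheory.measure_ne_top _ _)
  rw [Complex.norm_real, Real.norm_eq_abs, abs_of_pos hpos] at h2
  linarith

end Compact

/-! ### Topologies induced by groups of characters. -/

section CharTopology

variable {G : Type*} [AddCommGroup G]

/-- The evaluation homomorphism of a group into the product of circles indexed by a group of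
characters. -/
def charEval (H : AddSubgroup (G →+ UnitAddCircle)) : G →+ (H → UnitAddCircle) where
  toFun g χ := χ.1 g
  map_zero' := by ext; simp
  map_add' x y := by ext; simp

/-- The topology of pointwise convergence on a group of characters. -/
@[reducible] def charTopology (H : AddSubgroup (G →+ UnitAddCircle)) : TopologicalSpace G :=
  .induced (charEval H) inferInstance

theorem continuous_charTopology {H : AddSubgroup (G →+ UnitAddCircle)} {χ : G →+ UnitAddCircle}
    (hχ : χ ∈ H) : Continuous[charTopology H, inferInstance] χ := by
  let _ := charTopology H
  have h : Continuous (charEval H) := continuous_induced_dom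
  exact (continuous_apply (⟨χ, hχ⟩ : H)).comp h

theorem isPrecompactGroupTopology_charTopology (H : AddSubgroup (G →+ UnitAddCircle)) :
    IsPrecompactGroupTopology (charTopology H) := by
  let _ : UniformSpace G := .comap (charEval H) inferInstance
  have : IsUniformAddGroup G := IsUniformAddGroup.comap (charEval H)
  refine ⟨inferInstanceAs (IsTopologicalAddGroup G), fun U hU ⟨u, hu⟩ => ?_⟩
  have htb : TotallyBounded (Set.univ : Set G) := by
    have := totallyBounded_preimage (f := charEval H) (s := Set.univ) ⟨rfl⟩
      isCompact_univ.totallyBounded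
    simpa using this
  have hV : (u + ·) ⁻¹' U ∈ 𝓝 (0 : G) := by
    refine (IsOpen.preimage (continuous_const_add u) hU).mem_nhds ?_
    simpa using hu
  obtain ⟨F, hF, hcov⟩ := totallyBounded_iff_subset_finite_iUnion_nhds_zero.1 htb _ hV
  refine ⟨(· - u) '' F, hF.image _, Set.eq_univ_of_forall fun g => ?_⟩
  obtain ⟨y, hy, v, hv, hyv⟩ := Set.mem_iUnion₂.1 (hcov (Set.mem_univ g))
  refine ⟨y - u, ⟨y, hy, rfl⟩, u + v, hv, ?_⟩
  simp only [vadd_eq_add] at hyv ⊢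
  rw [← hyv]; abel

theorem isSCGroupTopology_charTopology {H : AddSubgroup (G →+ UnitAddCircle)}
    (hH : ∀ (L : AddSubgroup G) (g : G), g ∉ L → ∃ χ ∈ H, (∀ x ∈ L, χ x = 0) ∧ χ g ≠ 0) :
    IsSCGroupTopology (charTopology H) := by
  have hpre := isPrecompactGroupTopology_charTopology H
  have hcl : ∀ L : AddSubgroup G, IsClosed[charTopology H] (L : Set G) := by
    intro L
    let _ := charTopology H
    have : (L : Set G) = ⋂ χ ∈ {χ : G →+ UnitAddCircle | χ ∈ H ∧ ∀ x ∈ L, χ x = 0},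
        χ ⁻¹' {0} := by
      ext g
      simp only [Set.mem_iInter, Set.mem_ofPred_eq, SetLike.mem_coe, Set.mem_preimage,
        Set.mem_singleton_iff]
      refine ⟨fun hg χ hχ => hχ.2 g hg, fun h => ?_⟩
      by_contra hg
      obtain ⟨χ, hχ, h0, hne⟩ := hH L g hg
      exact hne (h χ ⟨hχ, h0⟩)
    rw [this]
    exact isClosed_biInter fun χ hχ => isClosed_singleton.preimage (continuous_charTopology hχ.1)
  refine ⟨⟨hpre, ?_⟩, hcl⟩
  let _ := charTopology H
  have : IsTopologicalAddGroup G := hpre.isTopologicalAddGroup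
  have h0 : IsClosed ({0} : Set G) := by simpa using hcl ⊥
  have : T1Space G := IsTopologicalAddGroup.t1Space G h0
  infer_instance

/-- Every continuous character of the topology of pointwise convergence on `H` is in `H`. -/
theorem mem_of_continuous_charTopology {H : AddSubgroup (G →+ UnitAddCircle)}
    {χ : G →+ UnitAddCircle} (hχ : Continuous[charTopology H, inferInstance] χ) : χ ∈ H := by
  let ι : G →+ (H → UnitAddCircle) × UnitAddCircle := (charEval H).prod χ
  let S : AddSubgroup ((H → UnitAddCircle) × UnitAddCircle) := ι.range.topologicalClosure
  have : CompactSpace S :=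
    isCompact_iff_compactSpace.1 (AddSubgroup.isClosed_topologicalClosure _).isCompact
  have hιS (g : G) : ι g ∈ S := AddSubgroup.le_topologicalClosure _ ⟨g, rfl⟩
  -- `S` is the closure of the graph of `χ` over the image of `G`; continuity of `χ` keeps it a
  -- graph, so the coordinates from `H` alone separate its points.
  have hS (t : UnitAddCircle) (ht : ((0 : H → UnitAddCircle), t) ∈ S) : t = 0 := by
    by_contra hne
    obtain ⟨V, W, hV, hW, h0, htW, hdisj⟩ := t2_separation (Ne.symm hne)
    have hpre : χ ⁻¹' V ∈ @nhds G (charTopology H) 0 := by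
      let _ := charTopology H
      exact (hV.preimage hχ).mem_nhds (by simpa using h0)
    rw [charTopology, nhds_induced, Filter.mem_comap] at hpre
    obtain ⟨N, hN, hNV⟩ := hpre
    rw [map_zero] at hN
    have hn : N ×ˢ W ∈ 𝓝 ((0 : H → UnitAddCircle), t) := prod_mem_nhds hN (hW.mem_nhds htW)
    have ht' : ((0 : H → UnitAddCircle), t) ∈ closure (ι.range : Set _) := ht
    obtain ⟨_, ⟨hx1, hx2⟩, ⟨g, rfl⟩⟩ := mem_closure_iff_nhds.1 ht' _ hn
    exact Set.disjoint_left.1 hdisj (hNV hx1) hx2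
  -- Characters of `S` whose restriction to `G` lies in `H`. Once `K = ⊤`, the last projection,
  -- which restricts to `χ`, belongs to it.
  let K : AddSubgroup (S →ₜ+ UnitAddCircle) :=
    { carrier := {η | ∃ ψ ∈ H, ∀ g, η ⟨ι g, hιS g⟩ = ψ g}
      zero_mem' := ⟨0, H.zero_mem, fun g => rfl⟩
      add_mem' := by
        rintro η η' ⟨ψ, hψ, h⟩ ⟨ψ', hψ', h'⟩
        refine ⟨ψ + ψ', H.add_mem hψ hψ', fun g => ?_⟩
        rw [ContinuousAddMonoidHom.add_apply, h, h', AddMonoidHom.add_apply]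
      neg_mem' := by
        rintro η ⟨ψ, hψ, h⟩
        refine ⟨-ψ, H.neg_mem hψ, fun g => ?_⟩
        rw [AddMonoidHom.neg_apply, ← h]
        rfl }
  have hK : K = ⊤ := by
    refine eq_top_of_separating K fun s hs => ?_
    have h1 : s.1.1 = 0 := by
      ext1 ψ
      exact hs
        { toFun s := s.1.1 ψ
          map_zero' := rfl
          map_add' _ _ := rfl
          continuous_toFun := by fun_prop } ⟨ψ.1, ψ.2, fun g => rfl⟩
    have h2 : s.1.2 = 0 := hS _ (by rw [← h1]; exact s.2)
    exact Subtype.ext (Prod.ext h1 h2)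
  let π : S →ₜ+ UnitAddCircle :=
    { toFun s := s.1.2
      map_zero' := rfl
      map_add' _ _ := rfl
      continuous_toFun := by fun_prop }
  have hπ : π ∈ K := by rw [hK]; trivial
  obtain ⟨ψ, hψ, h⟩ := hπ
  have : χ = ψ := AddMonoidHom.ext h
  rwa [this]

theorem charTopology_injective :
    Function.Injective (charTopology (G := G)) := by
  have key (H H' : AddSubgroup (G →+ UnitAddCircle)) (h : charTopology H = charTopology H') :
      H ≤ H' := fun χ hχ => mem_of_continuous_charTopology (h ▸ continuous_charTopology hχ)
  exact fun H H' h => le_antisymm (key _ _ h) (key _ _ h.symm)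

end CharTopology

/-! ### Prüfer groups and separation by kernels of rational functionals. -/

/-- The inclusion of the rational circle in the real one. -/
noncomputable def ratCircleToCircle : AddCircle (1 : ℚ) →+ UnitAddCircle :=
  QuotientAddGroup.map _ _ (Rat.castHom ℝ).toAddMonoidHom (by
    rw [AddSubgroup.zmultiples_le]
    simp)

theorem ratCircleToCircle_injective : Function.Injective ratCircleToCircle := by
  rw [injective_iff_map_eq_zero]
  intro z hz
  obtain ⟨q, rfl⟩ := QuotientAddGroup.mk_surjective z
  have h : ((q : ℝ) : UnitAddCircle) = 0 := hz
  rw [AddCircle.coe_eq_zero_iff] at h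
  obtain ⟨n, hn⟩ := h
  refine (AddCircle.coe_eq_zero_iff (1 : ℚ)).2 ⟨n, ?_⟩
  simp only [zsmul_eq_mul, mul_one] at hn ⊢
  exact_mod_cast hn

theorem exists_circleChar_ne_zero {A : Type*} [AddCommGroup A] {a : A} (ha : a ≠ 0) :
    ∃ χ : A →+ UnitAddCircle, χ a ≠ 0 := by
  obtain ⟨c, hc⟩ := CharacterModule.exists_character_apply_ne_zero_of_ne_zero ha
  exact ⟨ratCircleToCircle.comp c,
    fun h => hc (ratCircleToCircle_injective (h.trans (map_zero _).symm))⟩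

section Pruefer

variable (p : ℕ) [Fact p.Prime]

/-- The Prüfer group `ℚ_p / ℤ_p` as a module over the `p`-adic integers. -/
abbrev PadicPruefer : Type := ℚ_[p] ⧸ LinearMap.range (Algebra.linearMap ℤ_[p] ℚ_[p])

variable {p}

theorem PadicPruefer.mk_eq_zero_iff {x : ℚ_[p]} :
    (Submodule.Quotient.mk x : PadicPruefer p) = 0 ↔ ‖x‖ ≤ 1 := by
  rw [Submodule.Quotient.mk_eq_zero]
  constructor
  · rintro ⟨y, rfl⟩
    exact y.2
  · intro h
    exact ⟨⟨x, h⟩, rfl⟩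

variable (p) in
/-- The Prüfer group embeds in the circle. -/
theorem PadicPruefer.exists_injective :
    ∃ θ : PadicPruefer p →+ UnitAddCircle, Function.Injective θ := by
  have hp0 : (p : ℚ_[p]) ≠ 0 := by exact_mod_cast (Fact.out : p.Prime).ne_zero
  -- `z` has order `p`, and every nonzero element has a `p`-power multiple of the form `t • z` with
  -- `t` a unit; hence a character that is nonzero at `z` is injective.
  set z : PadicPruefer p := Submodule.Quotient.mk (p : ℚ_[p])⁻¹ with hz
  have hz0 : z ≠ 0 := by
    rw [Ne, PadicPruefer.mk_eq_zero_iff, norm_inv, Padic.norm_p, inv_inv, not_le]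
    exact_mod_cast (Fact.out : p.Prime).one_lt
  have hpz : (p : ℤ) • z = 0 := by
    rw [hz, ← Submodule.Quotient.mk_smul, zsmul_eq_mul, Int.cast_natCast, mul_inv_cancel₀ hp0,
      PadicPruefer.mk_eq_zero_iff]
    simp
  obtain ⟨θ, hθ⟩ := exists_circleChar_ne_zero hz0
  refine ⟨θ, (injective_iff_map_eq_zero θ).2 fun y hy => ?_⟩
  obtain ⟨x, rfl⟩ := Submodule.Quotient.mk_surjective _ y
  rw [PadicPruefer.mk_eq_zero_iff]
  by_contra! hx
  have hx0 : x ≠ 0 := by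
    rintro rfl
    simp at hx
    linarith
  have hp1 : (1 : ℝ) < p := by exact_mod_cast (Fact.out : p.Prime).one_lt
  obtain ⟨n, hn⟩ : ∃ n : ℕ, -x.valuation = n + 1 := by
    rw [Padic.norm_eq_zpow_neg_valuation hx0, one_lt_zpow_iff_right₀ hp1] at hx
    exact ⟨(-x.valuation - 1).toNat, by omega⟩
  have hxn : ‖x * (p : ℚ_[p]) ^ (n + 1)‖ = 1 := by
    rw [norm_mul, Padic.norm_p_pow, Padic.norm_eq_zpow_neg_valuation hx0, hn,
      ← zpow_add₀ (by positivity)]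
    simp
  let t : ℤ_[p] := ⟨x * (p : ℚ_[p]) ^ (n + 1), hxn.le⟩
  have htz : t • z = (p ^ n) • (Submodule.Quotient.mk x : PadicPruefer p) := by
    rw [hz, ← Submodule.Quotient.mk_smul, ← Submodule.Quotient.mk_smul]
    congr 1
    change x * (p : ℚ_[p]) ^ (n + 1) * (p : ℚ_[p])⁻¹ = _
    rw [nsmul_eq_mul, pow_succ]
    push_cast
    field_simp
  -- `θ` is only additive, so the `p`-adic scalar `t` is replaced by an integer congruent to it
  -- modulo `p`.
  obtain ⟨w, hw⟩ : (p : ℤ_[p]) ∣ t - t.zmodRepr := by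
    rw [← Ideal.mem_span_singleton, ← PadicInt.maximalIdeal_eq_span_p]
    exact PadicInt.sub_zmodRepr_mem t
  have hcop : IsCoprime (p : ℤ) (t.zmodRepr : ℤ) := by
    rw [Nat.isCoprime_iff_coprime, Nat.Prime.coprime_iff_not_dvd Fact.out]
    intro hd
    have h1 : (p : ℤ_[p]) ∣ t := by
      rw [sub_eq_iff_eq_add.1 hw]
      exact dvd_add (dvd_mul_right _ _) (by exact_mod_cast Nat.cast_dvd_cast (α := ℤ_[p]) hd)
    rw [← PadicInt.norm_lt_one_iff_dvd] at h1
    exact h1.ne hxn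
  have hmz : (t.zmodRepr : ℤ) • θ z = 0 := by
    have h1 : (t.zmodRepr : ℤ) • z = t • z := by
      conv_rhs => rw [sub_eq_iff_eq_add.1 hw, add_smul, mul_comm, mul_smul]
      have h2 : (p : ℤ_[p]) • z = 0 := by rw [← hpz, natCast_zsmul, Nat.cast_smul_eq_nsmul]
      rw [h2, smul_zero, zero_add, natCast_zsmul, Nat.cast_smul_eq_nsmul]
    rw [← map_zsmul, h1, htz, map_nsmul, hy, smul_zero]
  obtain ⟨a, b, hab⟩ := hcop
  apply hθ
  rw [← one_zsmul (θ z), ← hab, add_zsmul, mul_zsmul, mul_zsmul, hmz, ← map_zsmul θ (p : ℤ), hpz]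
  simp

end Pruefer

theorem not_countable_padicInt (p : ℕ) [Fact p.Prime] : ¬ Countable ℤ_[p] := by
  intro h
  have h1 : Cardinal.continuum ≤ Cardinal.mk (Metric.ball (0 : ℚ_[p]) 1) :=
    continuum_le_cardinal_of_isOpen ℚ_[p] Metric.isOpen_ball ⟨0, by simp⟩
  have h2 : (Metric.ball (0 : ℚ_[p]) 1).Countable := by
    refine (Set.countable_range (fun x : ℤ_[p] => (x : ℚ_[p]))).mono fun x hx => ?_
    exact Set.mem_range.2 ⟨(⟨x, (mem_ball_zero_iff.1 hx).le⟩ : ℤ_[p]), rfl⟩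
  exact (Cardinal.aleph0_lt_continuum.trans_le h1).not_ge (Cardinal.le_aleph0_iff_set_countable.2 h2)

/-- Take `p` dividing the denominator of a representative: the rational is then not `p`-integral, so
it survives in `ℚ_p / ℤ_p`. -/
theorem exists_pruefer_ne_zero {z : AddCircle (1 : ℚ)} (hz : z ≠ 0) :
    ∃ (p : ℕ) (_ : Fact p.Prime) (κ : AddCircle (1 : ℚ) →+ PadicPruefer p), κ z ≠ 0 := by
  obtain ⟨q, rfl⟩ := QuotientAddGroup.mk_surjective z
  have hq : q.den ≠ 1 := by
    intro h
    exact hz ((AddCircle.coe_eq_zero_iff (1 : ℚ)).2 ⟨q.num, by simpa using Rat.den_eq_one_iff q |>.1 h⟩)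
  obtain ⟨p, hp, hpd⟩ := Nat.exists_prime_and_dvd hq
  have := Fact.mk hp
  refine ⟨p, ⟨hp⟩, QuotientAddGroup.lift _
    ((LinearMap.range (Algebra.linearMap ℤ_[p] ℚ_[p])).mkQ.toAddMonoidHom.comp
      (Rat.castHom ℚ_[p]).toAddMonoidHom) ?_, ?_⟩
  · rw [AddSubgroup.zmultiples_le]
    refine PadicPruefer.mk_eq_zero_iff.2 ?_
    simp
  · intro h
    have h' : ‖(q : ℚ_[p])‖ ≤ 1 := PadicPruefer.mk_eq_zero_iff.1 h
    have h1 := PadicInt.isUnit_iff.1 (PadicInt.isUnit_den q h')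
    have h2 : ‖((q.den : ℤ) : ℤ_[p])‖ < 1 :=
      (PadicInt.norm_int_lt_one_iff_dvd _).2 (Int.natCast_dvd_natCast.2 hpd)
    rw [Int.cast_natCast, h1] at h2
    exact lt_irrefl _ h2

/-- Subgroups are closed for the topology of pointwise convergence on the kernel of a rational
functional on the character group. -/
theorem exists_mem_ker_separating {G : Type*} [AddCommGroup G] (φ : (G →+ UnitAddCircle) →+ ℚ)
    (L : AddSubgroup G) {g : G} (hg : g ∉ L) :
    ∃ χ ∈ φ.ker, (∀ x ∈ L, χ x = 0) ∧ χ g ≠ 0 := by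
  have hg' : (g : G ⧸ L) ≠ 0 := by rwa [Ne, QuotientAddGroup.eq_zero_iff]
  obtain ⟨c, hc⟩ := CharacterModule.exists_character_apply_ne_zero_of_ne_zero hg'
  obtain ⟨p, _, κ, hκ⟩ := exists_pruefer_ne_zero hc
  obtain ⟨θ, hθ⟩ := PadicPruefer.exists_injective p
  let ρ : G →+ PadicPruefer p := κ.comp ((c : G ⧸ L →+ AddCircle (1 : ℚ)).comp (QuotientAddGroup.mk' L))
  have hρL (x : G) (hx : x ∈ L) : ρ x = 0 := by
    have : (QuotientAddGroup.mk' L x) = 0 := (QuotientAddGroup.eq_zero_iff x).2 hx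
    change κ (c (QuotientAddGroup.mk' L x)) = 0
    rw [this, map_zero, map_zero]
  have hρg : ρ g ≠ 0 := hκ
  let Ψ : ℤ_[p] →+ (G →+ UnitAddCircle) :=
    { toFun a := θ.comp ((DistribSMul.toAddMonoidHom _ a).comp ρ)
      map_zero' := by ext x; simp
      map_add' a b := by ext x; simp [add_smul] }
  have hΨ (a : ℤ_[p]) (x : G) : Ψ a x = θ (a • ρ x) := rfl
  have hker : ∃ a, φ (Ψ a) = 0 ∧ a ≠ 0 := by
    by_contra! h
    have : Function.Injective (φ.comp Ψ) := (injective_iff_map_eq_zero _).2 h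
    exact not_countable_padicInt p this.countable
  obtain ⟨a, ha, ha0⟩ := hker
  set u := PadicInt.unitCoeff ha0
  have hau : a = p ^ a.valuation • (u : ℤ_[p]) := by
    conv_lhs => rw [PadicInt.unitCoeff_spec ha0]
    simp [mul_comm, u]
  refine ⟨Ψ u, ?_, fun x hx => by rw [hΨ, hρL x hx, smul_zero, map_zero], fun h => ?_⟩
  -- The power of `p` in `a` cancels because `ℚ` is torsion-free.
  · rw [hau, map_nsmul, map_nsmul, smul_eq_zero] at ha
    exact ha.resolve_left (pow_ne_zero _ (Fact.out : p.Prime).ne_zero)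
  · rw [hΨ, ← map_zero θ] at h
    have := hθ h
    apply hρg
    have h2 : (u⁻¹ : ℤ_[p]ˣ) • (u • ρ g) = 0 := by
      rw [show u • ρ g = 0 from this, smul_zero]
    rwa [inv_smul_smul] at h2

theorem isSCGroupTopology_charTopology_ker {G : Type*} [AddCommGroup G]
    (φ : (G →+ UnitAddCircle) →+ ℚ) : IsSCGroupTopology (charTopology φ.ker) :=
  isSCGroupTopology_charTopology fun L _ hg => exists_mem_ker_separating φ L hg

/-! ### Independent characters and the count of kernels. -/

/-- Continuum many elements of an abelian group with pairwise differences of infinite order contain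
continuum many independent elements. -/
theorem exists_linearIndepOn_of_nsmul_sub_ne_zero {X : Type*} [AddCommGroup X] {ι : Type}
    (hι : Cardinal.continuum ≤ Cardinal.mk ι) (f : ι → X)
    (hf : ∀ i j, i ≠ j → ∀ n : ℕ, n ≠ 0 → n • (f i - f j) ≠ 0) :
    ∃ s : Set ι, LinearIndepOn ℤ f s ∧ Cardinal.continuum ≤ Cardinal.mk s := by
  obtain ⟨s, hs, hmax⟩ := exists_maximal_linearIndepOn ℤ f
  refine ⟨s, hs, ?_⟩
  have h : ∀ i, ∃ (a : ℤ) (c : s →₀ ℤ), a ≠ 0 ∧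
      a • f i = Finsupp.linearCombination ℤ (fun j : s => f j) c := by
    intro i
    by_cases hi : i ∈ s
    · exact ⟨1, Finsupp.single ⟨i, hi⟩ 1, one_ne_zero, by simp⟩
    · obtain ⟨a, ha, hmem⟩ := hmax i hi
      rw [Set.image_eq_range, ← Finsupp.range_linearCombination] at hmem
      obtain ⟨c, hc⟩ := hmem
      exact ⟨a, c, ha, hc.symm⟩
  choose a c ha hac using h
  -- By maximality each `f i` has a nonzero multiple in the span of `s`. Equal data for `i ≠ j`
  -- would make `f i - f j` torsion, so `ι` is no larger than `ℤ × (s →₀ ℤ)`.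
  have hinj : Function.Injective fun i => (a i, c i) := by
    intro i j hij
    obtain ⟨h1, h2⟩ := Prod.mk.inj hij
    by_contra hne
    refine hf i j hne (a i).natAbs (Int.natAbs_ne_zero.2 (ha i)) ?_
    have h3 : a i • (f i - f j) = 0 := by
      rw [smul_sub, hac i, h1, hac j, h2, sub_self]
    rcases Int.natAbs_eq (a i) with h4 | h4
    · rw [h4, natCast_zsmul] at h3
      exact h3
    · rw [h4, neg_smul, natCast_zsmul, neg_eq_zero] at h3
      exact h3
  by_contra! hlt
  have h1 : Cardinal.mk (s →₀ ℤ) < Cardinal.continuum := by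
    rcases isEmpty_or_nonempty s with he | he
    · exact (Cardinal.mk_le_aleph0).trans_lt Cardinal.aleph0_lt_continuum
    · rw [Cardinal.mk_finsupp_of_infinite', Cardinal.mk_int]
      exact max_lt hlt Cardinal.aleph0_lt_continuum
  have h2 := Cardinal.mk_le_of_injective hinj
  rw [Cardinal.mk_prod, Cardinal.lift_id, Cardinal.lift_id, Cardinal.mk_int] at h2
  exact absurd (hι.trans h2)
    (Cardinal.mul_lt_of_lt Cardinal.aleph0_le_continuum Cardinal.aleph0_lt_continuum h1).not_ge

/-- Continuum many independent elements are separated by the kernels of rational functionals. -/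
theorem exists_ker_injective {X ι : Type*} [AddCommGroup X] {f : ι → X} {s : Set ι}
    (hs : LinearIndepOn ℤ f s) :
    ∃ φ : Set s → X →+ ℚ, Function.Injective fun S => (φ S).ker := by
  classical
  have h (S : Set s) : ∃ φ : X →+ ℚ, ∀ i : s, φ (f i) = if i ∈ S then 0 else 1 := by
    obtain ⟨φ, hφ⟩ := (Module.Baer.of_divisible ℚ).extension_property
      (Finsupp.linearCombination ℤ (fun j : s => f j)) hs
      (Finsupp.linearCombination ℤ (fun j : s => if j ∈ S then (0 : ℚ) else 1))
    refine ⟨φ.toAddMonoidHom, fun i => ?_⟩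
    have := congr($hφ (Finsupp.single i 1))
    simpa using this
  choose φ hφ using h
  refine ⟨φ, fun S S' hSS' => ?_⟩
  have hmem (S : Set s) (i : s) : i ∈ S ↔ f i ∈ (φ S).ker := by
    rw [AddMonoidHom.mem_ker, hφ]
    split_ifs with hi <;> simp [hi]
  ext i
  rw [hmem S, hmem S']
  exact iff_of_eq congr(f i ∈ $hSS')

universe u in
theorem two_power_continuum_le_of_nsmul_sub_ne_zero {G : Type u} [AddCommGroup G] {ι : Type}
    (hι : Cardinal.continuum ≤ Cardinal.mk ι) (f : ι → (G →+ UnitAddCircle))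
    (hf : ∀ i j, i ≠ j → ∀ n : ℕ, n ≠ 0 → n • (f i - f j) ≠ 0) :
    (2 : Cardinal) ^ Cardinal.continuum ≤
      Cardinal.mk {τ : TopologicalSpace G // IsSCGroupTopology τ} := by
  obtain ⟨s, hs, hcard⟩ := exists_linearIndepOn_of_nsmul_sub_ne_zero hι f hf
  obtain ⟨φ, hφ⟩ := exists_ker_injective hs
  let F : Set s → {τ : TopologicalSpace G // IsSCGroupTopology τ} :=
    fun S => ⟨charTopology (φ S).ker, isSCGroupTopology_charTopology_ker (φ S)⟩
  have hF : Function.Injective F := fun S S' h =>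
    hφ (charTopology_injective (congrArg Subtype.val h))
  have h1 := Cardinal.mk_le_of_injective (f := F ∘ ULift.down.{u}) (hF.comp ULift.down_injective)
  rw [Cardinal.mk_uLift, Cardinal.mk_set, Cardinal.lift_power, Cardinal.lift_two] at h1
  refine le_trans (Cardinal.power_le_power_left two_ne_zero ?_) h1
  rw [← Cardinal.lift_continuum.{u, 0}]
  exact Cardinal.lift_le.2 hcard

/-! ### Continuum many characters with nontorsion differences. -/

section Circle

variable {G : Type*} [AddCommGroup G]

theorem exists_circleChar_extension {A : Type*} [AddCommGroup A] {i : A →+ G}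
    (hi : Function.Injective i) (χ : A →+ UnitAddCircle) :
    ∃ ψ : G →+ UnitAddCircle, ψ.comp i = χ :=
  (Module.Baer.of_divisible _).extension_property_addMonoidHom i hi χ

/-- Nontorsion groups have continuum many characters with pairwise nontorsion differences. -/
theorem exists_chars_of_not_isOfFinAddOrder {g : G} (hg : ¬ IsOfFinAddOrder g) :
    ∃ (ι : Type) (f : ι → (G →+ UnitAddCircle)), Cardinal.continuum ≤ Cardinal.mk ι ∧
      ∀ i j, i ≠ j → ∀ n : ℕ, n ≠ 0 → n • (f i - f j) ≠ 0 := by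
  let Q : AddSubgroup ℝ := (Rat.castHom ℝ).toAddMonoidHom.range
  have hχ (r : ℝ) : ∃ χ : G →+ UnitAddCircle, χ g = (r : UnitAddCircle) := by
    obtain ⟨χ, hχ⟩ := exists_circleChar_extension (i := zmultiplesHom G g)
      (injective_zsmul_iff_not_isOfFinAddOrder.2 hg) (zmultiplesHom UnitAddCircle (r : UnitAddCircle))
    refine ⟨χ, ?_⟩
    have := congr($hχ 1)
    simpa using this
  choose χ hχ using hχ
  -- If `χ r - χ r'` is torsion, evaluating at `g` shows `r - r'` rational; hence one character per
  -- class modulo `ℚ`.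
  refine ⟨ℝ ⧸ Q, fun q => χ q.out, ?_, fun i j hij n hn h => hij ?_⟩
  · have h1 := (AddSubgroup.addGroupEquivQuotientProdAddSubgroup (s := Q)).cardinal_eq
    rw [Cardinal.mk_real, Cardinal.mk_prod, Cardinal.lift_id, Cardinal.lift_id] at h1
    have h2 : Cardinal.mk Q ≤ Cardinal.aleph0 :=
      Cardinal.le_aleph0_iff_set_countable.2 (Set.countable_range _)
    by_contra! hlt
    exact (Cardinal.mul_lt_of_lt Cardinal.aleph0_le_continuum hlt
      (h2.trans_lt Cardinal.aleph0_lt_continuum)).ne h1.symm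
  · rw [← QuotientAddGroup.out_eq' i, ← QuotientAddGroup.out_eq' j, QuotientAddGroup.eq]
    have h1 : n • ((j.out : UnitAddCircle) - (i.out : UnitAddCircle)) = 0 := by
      have := congr($h g)
      simp only [AddMonoidHom.nsmul_apply, AddMonoidHom.sub_apply, hχ,
        AddMonoidHom.zero_apply] at this
      rw [← neg_sub, smul_neg, this, neg_zero]
    rw [← AddCircle.coe_sub, ← AddCircle.coe_nsmul, AddCircle.coe_eq_zero_iff] at h1
    obtain ⟨m, hm⟩ := h1
    refine ⟨(m / n : ℚ), ?_⟩
    have hn' : (n : ℝ) ≠ 0 := by exact_mod_cast hn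
    simp only [zsmul_eq_mul, mul_one, nsmul_eq_mul] at hm
    change (((m : ℚ) / n : ℚ) : ℝ) = _
    push_cast
    rw [hm]
    field_simp
    ring

/-- If the range had finite order `m`, every character would kill `(m * M) • g`, and characters
separate points, so `G` would be bounded. -/
theorem infinite_range_nsmul_char (hG : ¬ IsOfBoundedOrder G) {M : ℕ} (hM : M ≠ 0) :
    (Set.range fun χ : G →+ UnitAddCircle => M • χ).Infinite := by
  intro hfin
  apply hG
  let R := (nsmulAddMonoidHom (α := G →+ UnitAddCircle) M).range
  have : Finite R := hfin
  refine ⟨Nat.card R * M, Nat.mul_pos Nat.card_pos (Nat.pos_of_ne_zero hM), fun g => ?_⟩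
  by_contra hne
  obtain ⟨χ, hχ⟩ := exists_circleChar_ne_zero hne
  apply hχ
  have h1 : Nat.card R • (⟨M • χ, χ, rfl⟩ : R) = 0 := card_nsmul_eq_zero'
  have h2 : Nat.card R • (M • χ) = 0 := congrArg Subtype.val h1
  rw [map_nsmul, mul_nsmul']
  exact congr($h2 g)

/-- Inductive step for the sequence: `E • χ` vanishes on everything killed by `E`, in particular on
earlier witnesses, while `E'` absorbs the orders of the new ones. -/
theorem exists_char_nsmul_add_ne_zero (hG : ¬ IsOfBoundedOrder G)
    (htor : ∀ g : G, IsOfFinAddOrder g) {N : ℕ} (hN : N ≠ 0)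
    (D : Finset (G →+ UnitAddCircle)) (E : ℕ+) :
    ∃ (χ : G →+ UnitAddCircle) (E' : ℕ+), (E : ℕ) ∣ E' ∧
      ∀ ψ ∈ D, ∃ g, (E' : ℕ) • g = 0 ∧ N • (ψ + (E : ℕ) • χ) g ≠ 0 := by
  classical
  obtain ⟨_, ⟨χ, rfl⟩, hχ⟩ :=
    (infinite_range_nsmul_char hG (mul_ne_zero hN E.ne_zero)).exists_notMem_finset
      (D.image fun ψ => -(N • ψ))
  have h (ψ : G →+ UnitAddCircle) : ∃ g, ψ ∈ D → N • (ψ + (E : ℕ) • χ) g ≠ 0 := by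
    by_contra! h
    refine hχ (Finset.mem_image.2 ⟨ψ, (h 0).1, ?_⟩)
    have h1 : N • (ψ + (E : ℕ) • χ) = 0 := AddMonoidHom.ext fun g => (h g).2
    rw [smul_add] at h1
    change -(N • ψ) = (N * (E : ℕ)) • χ
    rw [mul_nsmul', neg_eq_of_add_eq_zero_right h1]
  choose g hg using h
  refine ⟨χ, E * ∏ ψ ∈ D, ⟨addOrderOf (g ψ), (htor _).addOrderOf_pos⟩, ?_, fun ψ hψ => ⟨g ψ, ?_, hg ψ hψ⟩⟩
  · rw [PNat.mul_coe]
    exact dvd_mul_right _ _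
  · rw [← addOrderOf_dvd_iff_nsmul_eq_zero, PNat.mul_coe]
    refine dvd_mul_of_dvd_right ?_ _
    exact PNat.dvd_iff.1 (Finset.dvd_prod_of_mem
      (fun ψ => (⟨addOrderOf (g ψ), (htor _).addOrderOf_pos⟩ : ℕ+)) hψ)

open scoped Nat in
/-- In an unbounded torsion group there is a sequence of characters for which the failure of
`k !` to annihilate a signed sum of the first `k + 1` terms is witnessed by an element that all the
later terms annihilate. -/
theorem exists_char_sequence (hG : ¬ IsOfBoundedOrder G) (htor : ∀ g : G, IsOfFinAddOrder g) :
    ∃ δ : ℕ → (G →+ UnitAddCircle), ∀ d : ℕ → ℤ, (∀ j, d j = -1 ∨ d j = 0 ∨ d j = 1) →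
      ∀ k, ∃ g, (∀ i, k < i → δ i g = 0) ∧
        k ! • ((∑ j ∈ Finset.range k, d j • δ j) + δ k) g ≠ 0 := by
  classical
  have step (k : ℕ) (s : Finset (G →+ UnitAddCircle) × ℕ+) :=
    exists_char_nsmul_add_ne_zero hG htor (Nat.factorial_ne_zero k) s.1 s.2
  choose χ E' hdvd hwit using step
  let δ' (k : ℕ) (s : Finset (G →+ UnitAddCircle) × ℕ+) : G →+ UnitAddCircle := (s.2 : ℕ) • χ k s
  -- The state holds the signed sums of the terms so far and an exponent killing all witnesses so
  -- far.
  let σ : ℕ → Finset (G →+ UnitAddCircle) × ℕ+ := Nat.rec ({0}, 1) fun k s =>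
    (s.1 ∪ s.1.image (· + δ' k s) ∪ s.1.image (· - δ' k s), E' k s)
  have hσ (k : ℕ) : σ (k + 1) = ((σ k).1 ∪ (σ k).1.image (· + δ' k (σ k)) ∪
      (σ k).1.image (· - δ' k (σ k)), E' k (σ k)) := rfl
  have hmono {i j : ℕ} (hij : i ≤ j) : ((σ i).2 : ℕ) ∣ (σ j).2 := by
    induction j, hij using Nat.le_induction with
    | base => exact dvd_rfl
    | succ j _ ih => exact ih.trans (hdvd j (σ j))
  refine ⟨fun k => δ' k (σ k), fun d hd k => ?_⟩
  have hmem (k : ℕ) : ∑ j ∈ Finset.range k, d j • δ' j (σ j) ∈ (σ k).1 := by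
    induction k with
    | zero => simp [σ]
    | succ k ih =>
      rw [Finset.sum_range_succ, hσ]
      simp only [Finset.mem_union, Finset.mem_image]
      rcases hd k with h | h | h
      · exact Or.inr ⟨_, ih, by rw [h, neg_one_zsmul, sub_eq_add_neg]⟩
      · exact Or.inl (Or.inl (by rwa [h, zero_zsmul, add_zero]))
      · exact Or.inl (Or.inr ⟨_, ih, by rw [h, one_zsmul]⟩)
  obtain ⟨g, hg, hne⟩ := hwit k (σ k) _ (hmem k)
  refine ⟨g, fun i hi => ?_, hne⟩
  obtain ⟨m, hm⟩ := hmono (Nat.succ_le_of_lt hi)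
  change ((σ i).2 : ℕ) • χ i (σ i) g = 0
  rw [← map_nsmul, hm, mul_comm, mul_nsmul', show ((σ (k + 1)).2 : ℕ) • g = 0 from hg, smul_zero,
    map_zero]

/-- Unbounded torsion groups have continuum many characters with pairwise nontorsion differences. -/
theorem exists_chars_of_isOfFinAddOrder (hG : ¬ IsOfBoundedOrder G)
    (htor : ∀ g : G, IsOfFinAddOrder g) :
    ∃ f : (ℕ → Bool) → (G →+ UnitAddCircle),
      ∀ i j, i ≠ j → ∀ n : ℕ, n ≠ 0 → n • (f i - f j) ≠ 0 := by
  obtain ⟨δ, hδ⟩ := exists_char_sequence hG htor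
  -- On `A` the infinite sums of the `δ k` are finite at each point; divisibility of the circle
  -- extends them to `G`.
  let A : AddSubgroup G :=
    { carrier := {x | (Function.support fun k => δ k x).Finite}
      zero_mem' := by simp
      add_mem' := by
        intro x y hx hy
        refine (hx.union hy).subset ?_
        simp only [map_add]
        exact Function.support_add _ _
      neg_mem' := by
        intro x hx
        simpa using hx }
  -- Each bit `B i` is repeated at all positions `Nat.pair i n`. Since `n ≤ Nat.pair i n = k`, `n`
  -- divides `k !`, so nonvanishing after multiplying by `k !` rules out `n`-torsion.
  let e (B : ℕ → Bool) (k : ℕ) : ℤ := if B k.unpair.1 then 1 else 0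
  have hfin (B : ℕ → Bool) (x : A) : (Function.support fun k => e B k • δ k x).Finite :=
    x.2.subset fun k hk h => hk (by simp [show δ k x = 0 from h])
  let χ (B : ℕ → Bool) : A →+ UnitAddCircle :=
    { toFun x := ∑ᶠ k, e B k • δ k x
      map_zero' := by simp
      map_add' x y := by
        rw [← finsum_add_distrib (hfin B x) (hfin B y)]
        simp }
  have hext (B : ℕ → Bool) := exists_circleChar_extension (i := A.subtype) A.subtype_injective (χ B)
  choose f hf using hext
  have key (B B' : ℕ → Bool) (i : ℕ) (hi : B i = true) (hi' : B' i = false) (n : ℕ) (hn : n ≠ 0) :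
      n • (f B - f B') ≠ 0 := by
    intro h
    set k := Nat.pair i n with hk
    have hek : e B k - e B' k = 1 := by simp [e, hk, hi, hi']
    obtain ⟨g, hg, hne⟩ := hδ (fun j => e B j - e B' j) (fun j => by
      simp only [e]; split_ifs <;> simp) k
    have hsupp (B : ℕ → Bool) : (Function.support fun j => e B j • δ j g) ⊆ Finset.range (k + 1) := by
      intro j hj
      by_contra hjk
      simp only [Finset.coe_range, Set.mem_Iio, not_lt] at hjk
      exact hj (by simp [hg j hjk])
    have hgA : g ∈ A := by
      refine (Finset.finite_toSet (Finset.range (k + 1))).subset fun j hj => ?_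
      by_contra hjk
      simp only [Finset.coe_range, Set.mem_Iio, not_lt] at hjk
      exact hj (hg j hjk)
    have hval (B : ℕ → Bool) : f B g = ∑ j ∈ Finset.range (k + 1), e B j • δ j g := by
      have h1 : f B g = χ B ⟨g, hgA⟩ := congr($(hf B) ⟨g, hgA⟩)
      rw [h1]
      exact finsum_eq_sum_of_support_subset _ (hsupp B)
    obtain ⟨m, hm⟩ := Nat.dvd_factorial (Nat.pos_of_ne_zero hn) (Nat.right_le_pair i n)
    apply hne
    have h2 : ((∑ j ∈ Finset.range k, (e B j - e B' j) • δ j) + δ k) g = (f B - f B') g := by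
      rw [AddMonoidHom.sub_apply, hval, hval, ← Finset.sum_sub_distrib, Finset.sum_range_succ]
      simp only [AddMonoidHom.add_apply, AddMonoidHom.finsetSum_apply, AddMonoidHom.zsmul_apply,
        AddMonoidHom.sub_apply, sub_smul]
      rw [← sub_smul, hek, one_smul]
    rw [h2, hm, mul_comm, mul_nsmul', show n • (f B - f B') g = 0 from congr($h g), smul_zero]
  refine ⟨f, fun B B' hne n hn h => ?_⟩
  obtain ⟨i, hi⟩ := Function.ne_iff.1 hne
  cases hB : B i <;> cases hB' : B' i
  · exact hi (hB.trans hB'.symm)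
  · refine key B' B i hB' hB n hn ?_
    rw [← neg_sub, smul_neg, h, neg_zero]
  · exact key B B' i hB hB' n hn h
  · exact hi (hB.trans hB'.symm)

end Circle

/-! ### The two cardinal bounds. -/

theorem two_power_continuum_le_mk_isSCGroupTopology (G : Type*) [AddCommGroup G]
    (hG : ¬ IsOfBoundedOrder G) :
    (2 : Cardinal) ^ Cardinal.continuum ≤
      Cardinal.mk {τ : TopologicalSpace G // IsSCGroupTopology τ} := by
  by_cases htor : ∀ g : G, IsOfFinAddOrder g
  · obtain ⟨f, hf⟩ := exists_chars_of_isOfFinAddOrder hG htor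
    exact two_power_continuum_le_of_nsmul_sub_ne_zero (by simp) f hf
  · push Not at htor
    obtain ⟨g, hg⟩ := htor
    obtain ⟨ι, f, hι, hf⟩ := exists_chars_of_not_isOfFinAddOrder hg
    exact two_power_continuum_le_of_nsmul_sub_ne_zero hι f hf

theorem mk_topologicalSpace_le_of_countable (G : Type*) [Countable G] :
    Cardinal.mk (TopologicalSpace G) ≤ (2 : Cardinal) ^ Cardinal.continuum := by
  have h1 : Function.Injective fun τ : TopologicalSpace G => {U : Set G | IsOpen[τ] U} :=
    fun τ τ' h => TopologicalSpace.ext (by exact congrArg (fun A U => U ∈ A) h)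
  refine (Cardinal.mk_le_of_injective h1).trans ?_
  rw [Cardinal.mk_set, Cardinal.mk_set]
  refine Cardinal.power_le_power_left two_ne_zero ?_
  rw [← Cardinal.two_power_aleph0]
  exact Cardinal.power_le_power_left two_ne_zero Cardinal.mk_le_aleph0

theorem theoremC :
    (∀ (G : Type*) [AddCommGroup G], ¬ IsOfBoundedOrder G →
      (2 : Cardinal) ^ Cardinal.continuum ≤
        Cardinal.mk {τ : TopologicalSpace G // IsSCGroupTopology τ}) ∧
    (∀ (G : Type*) [AddCommGroup G] [Countable G], ¬ IsOfBoundedOrder G →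
      Cardinal.mk {τ : TopologicalSpace G // IsSCGroupTopology τ} =
        (2 : Cardinal) ^ Cardinal.continuum) :=
  ⟨two_power_continuum_le_mk_isSCGroupTopology, fun G _ _ hG =>
    le_antisymm ((Cardinal.mk_subtype_le _).trans (mk_topologicalSpace_le_of_countable G))
      (two_power_continuum_le_mk_isSCGroupTopology G hG)⟩
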